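/- Let $T$ be an infinite tree in which every vertex has finite degree, with a root $o$ of degree $1$. For each vertex $v\neq o$ let $v^{(0)}$ be its parent (its neighbour on the path to $o$) and let $v^{(1)},\dots,v^{(b(v))}$ be its $b(v)\ge 0$ children, labelled in any order. A rotor configuration is a map $r$ assigning to each vertex $v\ne o$ an integer $r(v)$ with $0\le r(v)\le b(v)$, meaning that the rotor at $v$ points to $v^{(r(v))}$; the rotor at $o$ always points to its only neighbour. In each step of the rotor walk, the rotor at the particle's current location $v$ is advanced to the next neighbour in the cyclic order $v^{(0)},v^{(1)},\dots,v^{(b(v))}$, and the particle then moves to that neighbour. Start a particle at $o$ and run the rotor walk until its first return to $o$. Either it returns after finitely many steps, or it never returns, in which case it visits each vertex only finitely often (it escapes to infinity); in both cases the final positions of all rotors are well defined. Run $n$ such walks from $o$ in succession, the first with initial configuration $r$ and each later one starting with the rotor positions left by its predecessor, and let $E_n(T,r)$ be the number of these $n$ particles that escape to infinity. Let $\alpha(T)$ be the probability that simple symmetric random walk on $T$ started at $o$ never returns to $o$. If $r$ is any rotor configuration for which only finitely many vertices $v\neq o$ satisfy $r(v)=b(v)$, then $$\lim_{n\to\infty}\frac{E_n(T,r)}{n}=\alpha(T).$$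 -/

import Mathlib

open MeasureTheory ProbabilityTheory Filter Topology

/-- A locally finite tree with a root of degree one, together with the cyclic orders of neighbours.
For `v ≠ root`, `nbr v 0` is the parent of `v`, and `nbr v 1, …, nbr v (b v)` are its `b v`
children, listed in the cyclic order in which the rotor at `v` serves them. -/
structure RotorTree (V : Type*) where
  graph : SimpleGraph V
  isTree : graph.IsTree
  root : V
  /-- Degree minus one: for `v ≠ root` this is the number of children of `v`. -/
  b : V → ℕ
  /-- The labelling `v^(0), …, v^(b)` of all neighbours of `v`. -/
  nbr : (v : V) → Fin (b v + 1) ≃ graph.neighborSet v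
  /-- The root has exactly one neighbour. -/
  b_root : b root = 0
  /-- For `v ≠ root`, the neighbour with label `0` is the one on the path from `v` to the root. -/
  nbr_zero : ∀ v, v ≠ root → ∀ p : graph.Walk v root, p.IsPath → (nbr v 0 : V) ∈ p.support

namespace RotorTree

variable {V : Type*} (T : RotorTree V)

/-- A rotor configuration: `0 ≤ r v ≤ b v` for all `v`, the rotor at `v` pointing to `nbr v (r v)`.
At the root there is only one possible value. -/
abbrev RotorConfig : Type _ := (v : V) → Fin (T.b v + 1)

open Classical in
/-- One step of the rotor walk: increment the rotor at the current location (addition in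
`Fin (b v + 1)` is cyclic), then move to the neighbour it now points to. -/
noncomputable def step (x : V × T.RotorConfig) : V × T.RotorConfig :=
  (T.nbr x.1 (x.2 x.1 + 1), Function.update x.2 x.1 (x.2 x.1 + 1))

/-- Location and rotors at time `t`, for the walk from the root with initial configuration `r`. -/
noncomputable def walk (r : T.RotorConfig) (t : ℕ) : V × T.RotorConfig :=
  T.step^[t] (T.root, r)

/-- The particle started at the root returns to the root. -/
def Returns (r : T.RotorConfig) : Prop :=
  ∃ t, 0 < t ∧ (T.walk r t).1 = T.root

open Classical in
/-- The rotor configuration once the walk is complete: the one at the first return to the root or,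
if there is no return, the eventual position of every rotor (which exists, see
`eventually_eq_after`). -/
noncomputable def after (r : T.RotorConfig) : T.RotorConfig :=
  if h : T.Returns r then (T.walk r (Nat.find h)).2
  else fun v => Classical.epsilon fun a => ∀ᶠ t in atTop, (T.walk r t).2 v = a

open Classical in
/-- The escape number `E_n(T, r)`: the number of particles, among `n` run successively from the
root, that never return to the root. -/
noncomputable def escapes (r : T.RotorConfig) (n : ℕ) : ℕ :=
  ((Finset.range n).filter fun i => ¬ T.Returns (T.after^[i] r)).card

lemma walk_succ (r : T.RotorConfig) (t : ℕ) : T.walk r (t + 1) = T.step (T.walk r t) :=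
  Function.iterate_succ_apply' _ _ _

lemma walk_rotor_of_ne (r : T.RotorConfig) (v : V) (t n : ℕ)
    (h : ∀ u, t ≤ u → u < t + n → (T.walk r u).1 ≠ v) :
    (T.walk r (t + n)).2 v = (T.walk r t).2 v := by
  classical
  induction n with
  | zero => rfl
  | succ n ih =>
    rw [← ih fun u h1 h2 => h u h1 (by omega), ← Nat.add_assoc, walk_succ]
    exact Function.update_of_ne (h (t + n) (by omega) (by omega)).symm _ _

open Fin.CommRing in
lemma frequently_nbr (r : T.RotorConfig) (v : V)
    (hv : ∃ᶠ t in atTop, (T.walk r t).1 = v) (k : Fin (T.b v + 1)) :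
    ∃ᶠ t in atTop, (T.walk r t).1 = T.nbr v k := by
  classical
  rw [frequently_atTop] at hv ⊢
  intro N
  obtain ⟨t₀, ht₀, hv₀⟩ := hv N
  have key : ∀ j : ℕ, ∃ t ≥ N, (T.walk r t).1 = v ∧
      (T.walk r t).2 v = (T.walk r t₀).2 v + (j : Fin (T.b v + 1)) := by
    intro j
    induction j with
    | zero => exact ⟨t₀, ht₀, hv₀, by simp⟩
    | succ j ih =>
      obtain ⟨t, ht, htv, hr⟩ := ih
      have hex : ∃ n, (T.walk r (t + 1 + n)).1 = v := by
        obtain ⟨s, hs, hsv⟩ := hv (t + 1)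
        exact ⟨s - (t + 1), by rwa [Nat.add_sub_cancel' hs]⟩
      refine ⟨t + 1 + Nat.find hex, by omega, Nat.find_spec hex, ?_⟩
      rw [walk_rotor_of_ne T r v (t + 1) (Nat.find hex) ?_, walk_succ]
      · subst htv
        simp only [step, Function.update_self, hr]
        push_cast
        rw [add_assoc]
      · intro u h1 h2 h3
        exact Nat.find_min hex (m := u - (t + 1)) (by omega) (by rwa [Nat.add_sub_cancel' h1])
  obtain ⟨t, ht, htv, hr⟩ := key (k - 1 - (T.walk r t₀).2 v : Fin (T.b v + 1)).val
  refine ⟨t + 1, by omega, ?_⟩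
  subst htv
  rw [walk_succ]
  simp only [step, hr]
  congr 2
  simp

/-- A walk that never returns to the root visits every vertex only finitely often, so that the
final rotor positions are well defined. -/
lemma eventually_eq_after (r : T.RotorConfig) (h : ¬ T.Returns r) (v : V) :
    ∀ᶠ t in atTop, (T.walk r t).2 v = T.after r v := by
  have hroot : ¬ ∃ᶠ t in atTop, (T.walk r t).1 = T.root := by
    intro hf
    obtain ⟨t, ht, htr⟩ := frequently_atTop.1 hf 1
    exact h ⟨t, ht, htr⟩
  have hfin : ¬ ∃ᶠ t in atTop, (T.walk r t).1 = v := by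
    obtain ⟨p⟩ := T.isTree.connected.preconnected v T.root
    have : ∀ {x y : V}, T.graph.Walk x y → (∃ᶠ t in atTop, (T.walk r t).1 = x) →
        ∃ᶠ t in atTop, (T.walk r t).1 = y := by
      intro x y p
      induction p with
      | nil => exact id
      | @cons x z y hxz p ih =>
        intro hx
        have := T.frequently_nbr r x hx ((T.nbr x).symm ⟨z, hxz⟩)
        rw [Equiv.apply_symm_apply] at this
        exact ih this
    exact fun hv => hroot (this p hv)
  have hex : ∃ a, ∀ᶠ t in atTop, (T.walk r t).2 v = a := by
    obtain ⟨N, hN⟩ := eventually_atTop.1 (not_frequently.1 hfin)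
    refine ⟨(T.walk r N).2 v, eventually_atTop.2 ⟨N, fun t ht => ?_⟩⟩
    have := T.walk_rotor_of_ne r v N (t - N) fun u hu _ => hN u hu
    rwa [Nat.add_sub_cancel' ht] at this
  rw [after, dif_neg h]
  exact Classical.epsilon_spec hex

section RandomWalk

variable [MeasurableSpace V] [DiscreteMeasurableSpace V]

/-- Transition kernel of simple random walk: move to a uniformly chosen neighbour. -/
noncomputable def srwKernel : Kernel V V where
  toFun v := ((PMF.uniformOfFintype (Fin (T.b v + 1))).map fun i => (T.nbr v i : V)).toMeasure
  measurable' := Measurable.of_discrete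

instance : IsMarkovKernel T.srwKernel :=
  ⟨fun _ => PMF.toMeasure.isProbabilityMeasure _⟩

/-- The law, on trajectories `ℕ → V`, of simple random walk started at `v`. -/
noncomputable def srwLaw (v : V) : Measure (ℕ → V) :=
  Kernel.traj (X := fun _ => V)
    (fun n => T.srwKernel.comap (fun x : (i : Finset.Iic n) → V => x ⟨n, by simp⟩)
      (measurable_pi_apply _))
    0 (fun _ => v)

/-- The probability that simple random walk started at the root never returns to the root. -/
noncomputable def escapeProb : ℝ :=
  (T.srwLaw T.root).real {ω | ∀ t, 0 < t → ω t ≠ T.root}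

end RandomWalk

end RotorTree

/-!
A particle at `v` makes excursions through the children of `v`, and it escapes below `v` exactly
when one of them escapes. If `α v` is the probability that simple random walk from `v` never moves
to the parent of `v`, this gives `α v = s / (1 + s)`, where `s` is the sum of `α` over the children
of `v`. The rotor at `v` serves the parent and the children cyclically, so among `n` excursions of
rotor walks from `v`, of which `k` return to the parent, every child receives `k` particles up to
one, and the escape numbers satisfy the same recursion up to bounded errors.

Iterated over finitely many levels below `v`, where the escape rate is at most `1`, the recursion
bounds the escape numbers from above. For the bound from below the errors must be summed over
infinitely many levels. If no rotor below `v` is about to point to a parent, then the first particle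
sent to any vertex below `v` escapes, and whenever a child receives one particle less than the
parent, its escape number is strictly smaller than that of `v`. Hence, if the escape number of `v`
is `e`, such errors occur at most `e` times along a ray. Moreover each level takes away as many
particles as the current escape number, so that `e` strict drops need about `e ^ 2 / 2 ≤ n`
particles. So the deficit `α v * n - e` is at most `√(2 * n)`.
Finitely many exceptional rotors are dealt with by moving finitely many levels down.
-/

section Algebra

lemma one_sub_div_one_add {s : ℝ} (hs : 0 ≤ s) : 1 - s / (1 + s) = 1 / (1 + s) := by
  field_simp
  ring

lemma sum_one_sub_mul {R : Type*} [Ring R] {n : ℕ} (a : Fin n → R) (x : R) :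
    ∑ i, (1 - a i) * x = (n - ∑ i, a i) * x := by
  simp [← Finset.sum_mul]

lemma min_sqrt_add_one_le {e e' n n' : ℝ} (he : e' + 1 ≤ e) (hn : n' + e ≤ n) (he0 : 0 ≤ e')
    (hn0 : 0 ≤ n') : min e' √(2 * n') + 1 ≤ min e √(2 * n) := by
  refine le_min (by linarith [min_le_left e' √(2 * n')]) ?_
  obtain hle | hlt := le_or_gt e √(2 * n)
  · linarith [min_le_left e' √(2 * n')]
  · have hsq : √(2 * n) ^ 2 = 2 * n := Real.sq_sqrt (by linarith)
    have h1 : 1 ≤ √(2 * n) := Real.one_le_sqrt.2 (by linarith)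
    have hsqrt : √(2 * n') ≤ √(2 * n) - 1 := Real.sqrt_le_left (by linarith) |>.2 (by nlinarith)
    linarith [min_le_right e' √(2 * n')]

end Algebra

section MarkovChain

variable {α : Type*}

/-- The trajectories that avoid `A` at the times `1, …, n`; time `0` is exempt, so that chains
started in `A` can be considered. -/
def avoids (A : Set α) (n : ℕ) : Set (ℕ → α) := {ω | ∀ t, 0 < t → t ≤ n → ω t ∉ A}

lemma avoids_zero (A : Set α) : avoids A 0 = Set.univ :=
  Set.eq_univ_of_forall fun _ _ h0 ht => absurd h0 ht.not_gt

lemma antitone_avoids (A : Set α) : Antitone (avoids A) :=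
  fun _ _ hmn _ hω t h0 ht => hω t h0 (ht.trans hmn)

lemma avoids_succ (A : Set α) (n : ℕ) : avoids A (n + 1) = avoids A n ∩ {ω | ω (n + 1) ∈ Aᶜ} := by
  ext ω
  refine ⟨fun h => ⟨antitone_avoids A n.le_succ h, h _ n.succ_pos le_rfl⟩, fun h t h0 ht => ?_⟩
  obtain rfl | ht := ht.eq_or_lt
  exacts [h.2, h.1 t h0 (Nat.lt_succ_iff.1 ht)]

lemma iInter_avoids (A : Set α) : ⋂ n, avoids A n = {ω | ∀ t, 0 < t → ω t ∉ A} := by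
  ext ω
  simp only [avoids, Set.mem_iInter, Set.mem_ofPred_eq]
  exact ⟨fun h t h0 => h t t h0 le_rfl, fun h n t h0 _ => h t h0⟩

variable [MeasurableSpace α]

lemma measurableSet_avoids {A : Set α} (hA : MeasurableSet A) (n : ℕ) :
    MeasurableSet (avoids A n) := by
  simp only [avoids, Set.ofPred_forall]
  exact .iInter fun t => .iInter fun _ => .iInter fun _ => hA.compl.preimage (measurable_pi_apply t)

lemma exists_preimage_frestrictLe_eq_avoids {A : Set α} (hA : MeasurableSet A) (n : ℕ) :
    ∃ S : Set (Finset.Iic n → α), MeasurableSet S ∧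
      Preorder.frestrictLe (π := fun _ => α) n ⁻¹' S = avoids A n := by
  refine ⟨{z | ∀ t : Finset.Iic n, 0 < (t : ℕ) → z t ∉ A}, ?_, ?_⟩
  · simp only [Set.ofPred_forall]
    exact .iInter fun t => .iInter fun _ => hA.compl.preimage (measurable_pi_apply t)
  · ext ω
    exact ⟨fun h t h0 ht => h ⟨t, Finset.mem_Iic.2 ht⟩ h0,
      fun h t h0 => h t h0 (Finset.mem_Iic.1 t.2)⟩

variable (κ : Kernel α α)

/-- The transition kernel `κ` of a Markov chain, applied to the last entry of the history of the
chain up to time `n`; this is the form of the transitions that `Kernel.traj` expects. -/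
noncomputable def historyKernel (n : ℕ) : Kernel (Finset.Iic n → α) α :=
  κ.comap (fun x : (i : Finset.Iic n) → α => x ⟨n, by simp⟩) (measurable_pi_apply _)

/-- The transition operator of the Markov chain that is killed when it enters `A`. -/
noncomputable def killedOp (A : Set α) (f : α → ENNReal) (x : α) : ENNReal :=
  ∫⁻ y in Aᶜ, f y ∂κ x

variable [IsMarkovKernel κ]

instance (n : ℕ) : IsMarkovKernel (historyKernel κ n) :=
  inferInstanceAs (IsMarkovKernel (κ.comap _ _))

/-- The law, on trajectories, of the Markov chain with transition kernel `κ` started at `x`. -/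
noncomputable def chainLaw (x : α) : Measure (ℕ → α) :=
  Kernel.traj (X := fun _ => α) (historyKernel κ) 0 (fun _ => x)

instance (x : α) : IsProbabilityMeasure (chainLaw κ x) :=
  inferInstanceAs (IsProbabilityMeasure (Kernel.traj _ 0 _))

lemma map_eval_zero_chainLaw (x : α) :
    (chainLaw κ x).map (fun ω => ω 0) = Measure.dirac x := by
  have h0 : Measurable fun z : Finset.Iic 0 → α => z ⟨0, by simp⟩ := measurable_pi_apply _
  calc (chainLaw κ x).map (fun ω => ω 0)
      = ((chainLaw κ x).map (Preorder.frestrictLe (π := fun _ => α) 0)).map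
          (fun z => z ⟨0, by simp⟩) := by
        rw [Measure.map_map h0 (by fun_prop)]
        rfl
    _ = Measure.dirac x := by
        rw [chainLaw, Kernel.traj_map_frestrictLe_apply, Kernel.partialTraj_self, Kernel.id_apply,
          Measure.map_dirac' h0]

lemma setLIntegral_chainLaw_succ (x : α) (n : ℕ) {S : Set (Finset.Iic n → α)}
    (hS : MeasurableSet S) {B : Set α} (hB : MeasurableSet B) {f : α → ENNReal}
    (hf : Measurable f) :
    ∫⁻ ω in Preorder.frestrictLe (π := fun _ => α) n ⁻¹' S ∩ {ω | ω (n + 1) ∈ B}, f (ω (n + 1))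
        ∂chainLaw κ x =
      ∫⁻ ω in Preorder.frestrictLe (π := fun _ => α) n ⁻¹' S, ∫⁻ y in B, f y ∂κ (ω n)
        ∂chainLaw κ x := by
  let μ := Kernel.partialTraj (X := fun _ => α) (historyKernel κ) 0 n fun _ => x
  have hpair : (chainLaw κ x).map (fun ω => (Preorder.frestrictLe (π := fun _ => α) n ω, ω (n + 1)))
      = μ.compProd (historyKernel κ n) :=
    (Kernel.partialTraj_compProd_eq_map_traj (X := fun _ => α) (κ := historyKernel κ)
      n.zero_le).symm
  have hhist : (chainLaw κ x).map (Preorder.frestrictLe (π := fun _ => α) n) = μ :=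
    Kernel.traj_map_frestrictLe_apply (X := fun _ => α) (κ := historyKernel κ) 0 n fun _ => x
  have hinner : Measurable fun z : Finset.Iic n → α => ∫⁻ y in B, f y ∂κ (z ⟨n, by simp⟩) :=
    (hf.setLIntegral_kernel hB).comp (measurable_pi_apply _)
  calc _ = ∫⁻ z in S ×ˢ B, f z.2 ∂μ.compProd (historyKernel κ n) := by
        rw [← hpair, setLIntegral_map (hS.prod hB) (by fun_prop) (by fun_prop)]
        rfl
    _ = ∫⁻ z in S, ∫⁻ y in B, f y ∂κ (z ⟨n, by simp⟩) ∂μ :=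
        Measure.setLIntegral_compProd (by fun_prop) hS hB
    _ = _ := by
        rw [← hhist, setLIntegral_map hS hinner (by fun_prop)]
        rfl

lemma setLIntegral_avoids {A : Set α} (hA : MeasurableSet A) (x : α) (n : ℕ) {f : α → ENNReal}
    (hf : Measurable f) :
    ∫⁻ ω in avoids A n, f (ω n) ∂chainLaw κ x = (killedOp κ A)^[n] f x := by
  induction n generalizing f with
  | zero =>
    rw [avoids_zero, setLIntegral_univ, Function.iterate_zero_apply, ← lintegral_dirac' x hf,
      ← map_eval_zero_chainLaw κ x, lintegral_map hf (measurable_pi_apply 0)]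
  | succ n ih =>
    obtain ⟨S, hS, hpre⟩ := exists_preimage_frestrictLe_eq_avoids hA n
    rw [avoids_succ, ← hpre, setLIntegral_chainLaw_succ κ x n hS hA.compl hf, hpre,
      Function.iterate_succ_apply]
    exact ih (hf.setLIntegral_kernel hA.compl)

lemma tendsto_killedOp_iterate_one {A : Set α} (hA : MeasurableSet A) (x : α) :
    Tendsto (fun n => (killedOp κ A)^[n] 1 x) atTop
      (𝓝 (chainLaw κ x {ω | ∀ t, 0 < t → ω t ∉ A})) := by
  have hmeas (n : ℕ) : (killedOp κ A)^[n] 1 x = chainLaw κ x (avoids A n) := by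
    simp [← setLIntegral_avoids κ hA x n measurable_one]
  simp only [hmeas, ← iInter_avoids]
  exact tendsto_measure_iInter_atTop (fun n => (measurableSet_avoids hA n).nullMeasurableSet)
    (antitone_avoids A) ⟨0, measure_ne_top _ _⟩

end MarkovChain

namespace RotorTree

variable {V : Type*} (T : RotorTree V)

section Descendants

/-- The neighbour of `v` on the path to the root; at the root itself, its only neighbour. -/
def parent (v : V) : V := T.nbr v 0

/-- The children of `v`, in the order in which the rotor at `v` serves them; `T.child v i` is the
neighbour `v^(i+1)`. -/
def child (v : V) (i : Fin (T.b v)) : V := T.nbr v i.succ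

/-- The distance to the root. -/
noncomputable def depth (v : V) : ℕ := T.graph.dist T.root v

/-- `T.Desc c u`: the vertex `u` lies in the subtree below `c`, that is, `u` is `c` or a descendant
of `c`. -/
inductive Desc (c : V) : V → Prop
  | refl : Desc c c
  | child {u : V} (i : Fin (T.b u)) : Desc c u → Desc c (T.child u i)

lemma adj_parent (v : V) : T.graph.Adj v (T.parent v) := (T.nbr v 0).2

lemma adj_child (v : V) (i : Fin (T.b v)) : T.graph.Adj v (T.child v i) := (T.nbr v i.succ).2

lemma child_injective (v : V) : Function.Injective (T.child v) := fun _ _ h =>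
  Fin.succ_injective _ ((T.nbr v).injective (Subtype.ext h))

@[simp]
lemma depth_root : T.depth T.root = 0 := SimpleGraph.dist_self

lemma eq_parent_of_adj_of_depth_eq {v w : V} (h : T.graph.Adj v w)
    (hd : T.depth v = T.depth w + 1) : w = T.parent v := by
  have hv : v ≠ T.root := by
    rintro rfl
    simp at hd
  obtain ⟨q, hq⟩ := T.isTree.connected.exists_walk_length_eq_dist w T.root
  have hp : (q.cons h).IsPath := by
    refine SimpleGraph.Walk.isPath_of_length_eq_dist _ ?_
    rw [SimpleGraph.Walk.length_cons, hq, SimpleGraph.dist_comm, SimpleGraph.dist_comm (u := v)]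
    exact hd.symm
  have hsnd := T.isTree.isAcyclic.eq_snd_of_adj_start hp (T.adj_parent v) (T.nbr_zero v hv _ hp)
  simpa using hsnd.symm

lemma depth_parent {v : V} (hv : v ≠ T.root) : T.depth v = T.depth (T.parent v) + 1 := by
  classical
  refine (T.isTree.dist_eq_dist_add_one_of_adj T.root (T.adj_parent v)).resolve_right fun h => ?_
  obtain ⟨p, hp⟩ := T.isTree.connected.exists_walk_length_eq_dist v T.root
  have hmem : T.parent v ∈ p.support :=
    T.nbr_zero v hv p (SimpleGraph.Walk.isPath_of_length_eq_dist _ hp)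
  have hle : T.graph.dist (T.parent v) T.root ≤ T.graph.dist v T.root :=
    hp ▸ (SimpleGraph.dist_le _).trans (p.length_dropUntil_le_length hmem)
  rw [SimpleGraph.dist_comm, SimpleGraph.dist_comm (u := v)] at hle
  omega

lemma depth_child {v : V} (i : Fin (T.b v)) : T.depth (T.child v i) = T.depth v + 1 := by
  refine (T.isTree.dist_eq_dist_add_one_of_adj T.root (T.adj_child v i)).resolve_left fun h => ?_
  have hi := T.eq_parent_of_adj_of_depth_eq (T.adj_child v i) h
  exact Fin.succ_ne_zero i ((T.nbr v).injective (Subtype.ext hi))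

lemma parent_child {v : V} (i : Fin (T.b v)) : T.parent (T.child v i) = v :=
  (T.eq_parent_of_adj_of_depth_eq (T.adj_child v i).symm (T.depth_child i)).symm

lemma child_ne_root {v : V} (i : Fin (T.b v)) : T.child v i ≠ T.root := fun h => by
  simpa [h] using T.depth_child i

lemma parent_root_ne_root : T.parent T.root ≠ T.root := (T.adj_parent T.root).ne'

lemma parent_parent_root : T.parent (T.parent T.root) = T.root := by
  refine (T.eq_parent_of_adj_of_depth_eq (T.adj_parent T.root).symm ?_).symm
  refine (T.isTree.dist_eq_dist_add_one_of_adj T.root (T.adj_parent T.root)).resolve_left ?_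
  simp

variable {T}

namespace Desc

variable {a c c' u v : V}

lemma ne_root (hc : c ≠ T.root) (h : T.Desc c u) : u ≠ T.root := by
  cases h with
  | refl => exact hc
  | child i _ => exact T.child_ne_root i

lemma trans (h : T.Desc a c) (h' : T.Desc c u) : T.Desc a u := by
  induction h' with
  | refl => exact h
  | child i _ ih => exact ih.child i

lemma depth_le (h : T.Desc c u) : T.depth c ≤ T.depth u := by
  induction h with
  | refl => rfl
  | child i _ ih => rw [T.depth_child]; omega

lemma parent (h : T.Desc c u) (hu : u ≠ c) : T.Desc c (T.parent u) := by
  cases h with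
  | refl => exact absurd rfl hu
  | child i h => rwa [T.parent_child]

lemma eq_of_depth_eq (h : T.Desc c u) (h' : T.Desc c' u) (hd : T.depth c = T.depth c') :
    c = c' := by
  induction h with
  | refl =>
    cases h' with
    | refl => rfl
    | child i h' =>
      have := h'.depth_le
      rw [T.depth_child] at hd
      omega
  | @child u i h ih =>
    have hne : T.child u i ≠ c' := fun he => by
      have := h.depth_le
      rw [← he, T.depth_child] at hd
      omega
    exact ih (T.parent_child i ▸ h'.parent hne)

lemma child_index_unique {i j : Fin (T.b v)} (h : T.Desc (T.child v i) u)
    (h' : T.Desc (T.child v j) u) : i = j :=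
  T.child_injective v (h.eq_of_depth_eq h' (by rw [T.depth_child, T.depth_child]))

end Desc

lemma not_desc_child {v : V} (i : Fin (T.b v)) : ¬ T.Desc (T.child v i) v := fun h => by
  have := h.depth_le
  rw [T.depth_child] at this
  omega

lemma Desc.ne_of_child {v u : V} {i : Fin (T.b v)} (h : T.Desc (T.child v i) u) : u ≠ v := by
  rintro rfl
  exact not_desc_child i h

lemma Desc.ne_parent {v u : V} (hv : v ≠ T.root) (h : T.Desc v u) : u ≠ T.parent v := by
  rintro rfl
  have := h.depth_le
  rw [T.depth_parent hv] at this
  omega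

end Descendants

section StoppedWalk

open Classical in
/-- One step of the rotor walk that stops when it reaches the vertex `a`. Stopping makes a walk
that reaches `a` and one that does not obey the same invariants at all times. -/
noncomputable def stoppedStep (a : V) (x : V × T.RotorConfig) : V × T.RotorConfig :=
  if x.1 = a then x else T.step x

/-- The rotor walk started from the state `x` hits the vertex `a`. -/
def Hits (a : V) (x : V × T.RotorConfig) : Prop := ∃ t, ((T.stoppedStep a)^[t] x).1 = a

/-- The final positions of all rotors for the rotor walk started from the state `x` and stopped at
`a`, whether or not it hits `a`. -/
noncomputable def finalRotors (a : V) (x : V × T.RotorConfig) : T.RotorConfig := fun u =>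
  Classical.epsilon fun k => ∀ᶠ t in atTop, ((T.stoppedStep a)^[t] x).2 u = k

variable {T} {a a' : V} {x : V × T.RotorConfig}

lemma stoppedStep_of_eq (hx : x.1 = a) : T.stoppedStep a x = x := if_pos hx

lemma stoppedStep_of_ne (hx : x.1 ≠ a) : T.stoppedStep a x = T.step x := if_neg hx

lemma iterate_stoppedStep_of_eq (hx : x.1 = a) (t : ℕ) : (T.stoppedStep a)^[t] x = x :=
  Function.iterate_fixed (stoppedStep_of_eq hx) t

lemma iterate_stoppedStep_of_forall_ne {t : ℕ} (h : ∀ s < t, (T.step^[s] x).1 ≠ a) :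
    (T.stoppedStep a)^[t] x = T.step^[t] x := by
  induction t with
  | zero => rfl
  | succ t ih =>
    rw [Function.iterate_succ_apply', Function.iterate_succ_apply',
      ih fun s hs => h s (hs.trans t.lt_succ_self), stoppedStep_of_ne (h t t.lt_succ_self)]

lemma hits_iterate_stoppedStep (t : ℕ) : T.Hits a ((T.stoppedStep a)^[t] x) ↔ T.Hits a x := by
  refine ⟨fun ⟨s, hs⟩ => ⟨s + t, by rwa [Function.iterate_add_apply]⟩, fun ⟨s, hs⟩ => ⟨s, ?_⟩⟩
  rwa [← Function.iterate_add_apply, add_comm, Function.iterate_add_apply,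
    iterate_stoppedStep_of_eq hs]

lemma finalRotors_iterate_stoppedStep (t : ℕ) :
    T.finalRotors a ((T.stoppedStep a)^[t] x) = T.finalRotors a x := by
  funext u
  refine congrArg _ (funext fun k => ?_)
  simp only [← Function.iterate_add_apply]
  rw [← eventually_map (m := (· + t)) (P := fun s => ((T.stoppedStep a)^[s] x).2 u = k),
    map_add_atTop_eq_nat]

lemma hits_step (hx : x.1 ≠ a) : T.Hits a (T.step x) ↔ T.Hits a x := by
  rw [← stoppedStep_of_ne hx]
  exact hits_iterate_stoppedStep 1

lemma finalRotors_step (hx : x.1 ≠ a) : T.finalRotors a (T.step x) = T.finalRotors a x := by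
  rw [← stoppedStep_of_ne hx]
  exact finalRotors_iterate_stoppedStep 1

lemma hits_of_eq (hx : x.1 = a) : T.Hits a x := ⟨0, hx⟩

lemma finalRotors_of_forall_eq {u : V} {k : Fin (T.b u + 1)}
    (h : ∀ t, ((T.stoppedStep a)^[t] x).2 u = k) : T.finalRotors a x u = k := by
  simp only [finalRotors, h, eventually_const]
  exact (Classical.epsilon_spec (p := fun j => k = j) ⟨k, rfl⟩).symm

lemma finalRotors_of_eq (hx : x.1 = a) : T.finalRotors a x = x.2 :=
  funext fun u => finalRotors_of_forall_eq fun t => by rw [iterate_stoppedStep_of_eq hx]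

lemma Hits.exists_iterate_eq (h : T.Hits a x) :
    ∃ t, (T.stoppedStep a)^[t] x = (a, T.finalRotors a x) := by
  obtain ⟨t, ht⟩ := h
  exact ⟨t, Prod.ext ht (by rw [← finalRotors_iterate_stoppedStep t, finalRotors_of_eq ht])⟩

lemma hits_iterate_stoppedStep_of_avoids (h : ∀ s, ((T.stoppedStep a')^[s] x).1 ≠ a) (t : ℕ) :
    (T.Hits a ((T.stoppedStep a')^[t] x) ↔ T.Hits a x) ∧
      T.finalRotors a ((T.stoppedStep a')^[t] x) = T.finalRotors a x := by
  induction t with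
  | zero => exact ⟨Iff.rfl, rfl⟩
  | succ t ih =>
    rw [Function.iterate_succ_apply']
    by_cases ht : ((T.stoppedStep a')^[t] x).1 = a'
    · rwa [stoppedStep_of_eq ht]
    · rwa [stoppedStep_of_ne ht, hits_step (h t), finalRotors_step (h t)]

/-- The strong Markov property of the rotor walk. -/
lemma Hits.restart (h' : T.Hits a' x) (h : ∀ s, ((T.stoppedStep a')^[s] x).1 ≠ a) :
    (T.Hits a x ↔ T.Hits a (a', T.finalRotors a' x)) ∧
      T.finalRotors a x = T.finalRotors a (a', T.finalRotors a' x) := by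
  obtain ⟨t, ht⟩ := h'.exists_iterate_eq
  rw [← ht]
  have := hits_iterate_stoppedStep_of_avoids h t
  exact ⟨this.1.symm, this.2.symm⟩

lemma not_hits_of_avoids (h' : ¬ T.Hits a' x) (h : ∀ s, ((T.stoppedStep a')^[s] x).1 ≠ a) :
    ¬ T.Hits a x ∧ T.finalRotors a x = T.finalRotors a' x := by
  have heq (t : ℕ) : (T.stoppedStep a)^[t] x = (T.stoppedStep a')^[t] x := by
    induction t with
    | zero => rfl
    | succ t ih =>
      rw [Function.iterate_succ_apply', Function.iterate_succ_apply', ih, stoppedStep_of_ne (h t),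
        stoppedStep_of_ne fun ht => h' ⟨t, ht⟩]
  exact ⟨fun ⟨t, ht⟩ => h t (heq t ▸ ht), by unfold finalRotors; simp only [heq]⟩

lemma hits_iff_exists_iterate_step : T.Hits a x ↔ ∃ t, (T.step^[t] x).1 = a := by
  classical
  constructor
  · rintro ⟨t, ht⟩
    by_contra! h
    exact h t (iterate_stoppedStep_of_forall_ne (fun s _ => h s) ▸ ht)
  · intro h
    exact ⟨Nat.find h, (iterate_stoppedStep_of_forall_ne fun s hs => Nat.find_min h hs).symm ▸
      Nat.find_spec h⟩

lemma finalRotors_of_first_hit {t : ℕ} (ht : (T.step^[t] x).1 = a)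
    (h : ∀ s < t, (T.step^[s] x).1 ≠ a) : T.finalRotors a x = (T.step^[t] x).2 := by
  rw [← finalRotors_iterate_stoppedStep t, iterate_stoppedStep_of_forall_ne h,
    finalRotors_of_eq ht]

lemma finalRotors_of_not_hits (h : ¬ T.Hits a x) : T.finalRotors a x = fun u =>
    Classical.epsilon fun k => ∀ᶠ t in atTop, (T.step^[t] x).2 u = k := by
  have hne (t : ℕ) : (T.step^[t] x).1 ≠ a := fun ht => h (hits_iff_exists_iterate_step.2 ⟨t, ht⟩)
  unfold finalRotors
  simp only [fun t => iterate_stoppedStep_of_forall_ne (t := t) fun s _ => hne s]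

open Classical in
lemma step_last {v : V} {r : T.RotorConfig} (h : r v = Fin.last _) :
    T.step (v, r) = (T.parent v, Function.update r v 0) := by
  simp only [step, h, Fin.last_add_one, parent]

open Classical in
lemma step_castSucc {v : V} {r : T.RotorConfig} {i : Fin (T.b v)} (h : r v = i.castSucc) :
    T.step (v, r) = (T.child v i, Function.update r v i.succ) := by
  simp only [step, h, Fin.coeSucc_eq_succ, child]

end StoppedWalk

section Root

variable {T}

lemma step_root (r : T.RotorConfig) : T.step (T.root, r) = (T.parent T.root, r) := by
  classical
  have : Subsingleton (Fin (T.b T.root + 1)) := Fin.subsingleton_iff_le_one.2 (by rw [T.b_root])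
  rw [step_last (Subsingleton.elim _ _), Function.update_eq_self_iff.2 (Subsingleton.elim _ _)]

lemma walk_succ_eq (r : T.RotorConfig) (t : ℕ) :
    T.walk r (t + 1) = T.step^[t] (T.parent T.root, r) := by
  rw [walk, Function.iterate_succ_apply, step_root]

lemma returns_iff_hits (r : T.RotorConfig) :
    T.Returns r ↔ T.Hits T.root (T.parent T.root, r) := by
  rw [hits_iff_exists_iterate_step]
  constructor
  · rintro ⟨t, ht, h⟩
    obtain ⟨s, rfl⟩ := Nat.exists_eq_add_one.2 ht
    exact ⟨s, by rwa [walk_succ_eq] at h⟩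
  · rintro ⟨s, h⟩
    exact ⟨s + 1, s.succ_pos, by rwa [walk_succ_eq]⟩

lemma after_eq_finalRotors (r : T.RotorConfig) :
    T.after r = T.finalRotors T.root (T.parent T.root, r) := by
  classical
  by_cases h : T.Returns r
  · obtain ⟨s, hs⟩ := Nat.exists_eq_add_one.2 (Nat.find_spec h).1
    have hhit : (T.step^[s] (T.parent T.root, r)).1 = T.root := by
      rw [← walk_succ_eq, ← hs]
      exact (Nat.find_spec h).2
    have hfirst : ∀ q < s, (T.step^[q] (T.parent T.root, r)).1 ≠ T.root := fun q hq he =>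
      Nat.find_min h (m := q + 1) (by omega) ⟨q.succ_pos, by rwa [walk_succ_eq]⟩
    rw [after, dif_pos h, hs, walk_succ_eq, finalRotors_of_first_hit hhit hfirst]
  · rw [after, dif_neg h, finalRotors_of_not_hits (mt (returns_iff_hits r).2 h)]
    funext u
    refine congrArg _ (funext fun k => ?_)
    simp only [← walk_succ_eq]
    rw [← eventually_map (m := (· + 1)) (P := fun t => (T.walk r t).2 u = k),
      map_add_atTop_eq_nat]

end Root

section Excursion

/-- The excursion of a particle from `v`, with initial rotors `r`, ends at the parent of `v`. -/
def ExcursionReturns (v : V) (r : T.RotorConfig) : Prop := T.Hits (T.parent v) (v, r)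

/-- The rotors after a particle has made an excursion from `v`, which ends at the parent of `v` or
escapes to infinity. -/
noncomputable def afterExcursion (v : V) (r : T.RotorConfig) : T.RotorConfig :=
  T.finalRotors (T.parent v) (v, r)

open Classical in
/-- The escape number of the subtree below `v`: the number of excursions from `v`, among `n` made
successively, that escape to infinity. -/
noncomputable def excursionEscapes (v : V) (r : T.RotorConfig) (n : ℕ) : ℕ :=
  Nat.count (fun i => ¬ T.ExcursionReturns v ((T.afterExcursion v)^[i] r)) n

variable {T} {v u : V} {r r' : T.RotorConfig}

@[simp]
lemma excursionEscapes_zero (v : V) (r : T.RotorConfig) : T.excursionEscapes v r 0 = 0 := by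
  classical
  exact Nat.count_zero _

open Classical in
lemma excursionEscapes_succ (v : V) (r : T.RotorConfig) (n : ℕ) :
    T.excursionEscapes v r (n + 1) = T.excursionEscapes v r n +
      if T.ExcursionReturns v ((T.afterExcursion v)^[n] r) then 0 else 1 := by
  rw [excursionEscapes, Nat.count_succ, ite_not, excursionEscapes]

lemma excursionEscapes_mono (v : V) (r : T.RotorConfig) : Monotone (T.excursionEscapes v r) := by
  classical
  exact Nat.count_monotone _

lemma excursionEscapes_le (v : V) (r : T.RotorConfig) (n : ℕ) : T.excursionEscapes v r n ≤ n := by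
  classical
  exact Nat.count_le _

lemma escapes_eq_excursionEscapes (r : T.RotorConfig) (n : ℕ) :
    T.escapes r n = T.excursionEscapes (T.parent T.root) r n := by
  classical
  have hreturns (σ : T.RotorConfig) : T.Returns σ ↔ T.ExcursionReturns (T.parent T.root) σ := by
    rw [returns_iff_hits, ExcursionReturns, T.parent_parent_root]
  have hafter : T.after = T.afterExcursion (T.parent T.root) := by
    funext σ
    rw [after_eq_finalRotors, afterExcursion, T.parent_parent_root]
  rw [escapes, excursionEscapes, Nat.count_eq_card_filter_range]
  exact congrArg _ (Finset.filter_congr fun i _ => by rw [hreturns, hafter])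

lemma Desc.step_fst {x : V × T.RotorConfig} (hx : T.Desc v x.1) :
    (T.step x).1 = T.parent v ∨ T.Desc v (T.step x).1 := by
  obtain ⟨a, σ⟩ := x
  obtain ⟨i, h⟩ | h := (σ a).eq_castSucc_or_eq_last
  · rw [step_castSucc h]
    exact .inr (hx.child i)
  · rw [step_last h]
    obtain rfl | hav := eq_or_ne a v
    exacts [.inl rfl, .inr (hx.parent hav)]

lemma iterate_stoppedStep_fst (v : V) (r : T.RotorConfig) (t : ℕ) :
    ((T.stoppedStep (T.parent v))^[t] (v, r)).1 = T.parent v ∨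
      T.Desc v ((T.stoppedStep (T.parent v))^[t] (v, r)).1 := by
  induction t with
  | zero => exact .inr .refl
  | succ t ih =>
    rw [Function.iterate_succ_apply']
    by_cases ht : ((T.stoppedStep (T.parent v))^[t] (v, r)).1 = T.parent v
    · exact .inl (by rwa [stoppedStep_of_eq ht])
    · rw [stoppedStep_of_ne ht]
      exact (ih.resolve_left ht).step_fst

lemma iterate_stoppedStep_snd_of_not_desc (hu : ¬ T.Desc v u) (t : ℕ) :
    ((T.stoppedStep (T.parent v))^[t] (v, r)).2 u = r u := by
  classical
  induction t with
  | zero => rfl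
  | succ t ih =>
    rw [Function.iterate_succ_apply', ← ih]
    by_cases ht : ((T.stoppedStep (T.parent v))^[t] (v, r)).1 = T.parent v
    · rw [stoppedStep_of_eq ht]
    · rw [stoppedStep_of_ne ht]
      have hdesc := (iterate_stoppedStep_fst v r t).resolve_left ht
      have hne : u ≠ ((T.stoppedStep (T.parent v))^[t] (v, r)).1 := by
        rintro rfl
        exact hu hdesc
      exact Function.update_of_ne hne _ _

lemma step_congr {s : Set V} {x x' : V × T.RotorConfig} (hx : x.1 ∈ s) (h1 : x'.1 = x.1)
    (h2 : ∀ u ∈ s, x'.2 u = x.2 u) :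
    (T.step x').1 = (T.step x).1 ∧ ∀ u ∈ s, (T.step x').2 u = (T.step x).2 u := by
  classical
  obtain ⟨a, σ⟩ := x
  obtain ⟨a', σ'⟩ := x'
  obtain rfl : a' = a := h1
  have ha : σ' a' = σ a' := h2 a' hx
  refine ⟨by simp only [step, ha], fun u hu => ?_⟩
  obtain rfl | hua := eq_or_ne u a'
  · simp only [step, ha, Function.update_self]
  · simp only [step, Function.update_of_ne hua]
    exact h2 u hu

lemma iterate_stoppedStep_congr (h : ∀ u, T.Desc v u → r' u = r u) (t : ℕ) :
    ((T.stoppedStep (T.parent v))^[t] (v, r')).1 = ((T.stoppedStep (T.parent v))^[t] (v, r)).1 ∧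
      ∀ u, T.Desc v u → ((T.stoppedStep (T.parent v))^[t] (v, r')).2 u =
        ((T.stoppedStep (T.parent v))^[t] (v, r)).2 u := by
  induction t with
  | zero => exact ⟨rfl, h⟩
  | succ t ih =>
    rw [Function.iterate_succ_apply', Function.iterate_succ_apply']
    by_cases ht : ((T.stoppedStep (T.parent v))^[t] (v, r)).1 = T.parent v
    · rwa [stoppedStep_of_eq ht, stoppedStep_of_eq (ih.1.trans ht)]
    · rw [stoppedStep_of_ne ht, stoppedStep_of_ne fun h' => ht (ih.1.symm.trans h')]
      have hdesc := (iterate_stoppedStep_fst v r t).resolve_left ht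
      exact step_congr (s := {u | T.Desc v u}) hdesc ih.1 ih.2

lemma excursionReturns_congr (h : ∀ u, T.Desc v u → r' u = r u) :
    T.ExcursionReturns v r' ↔ T.ExcursionReturns v r :=
  exists_congr fun t => by rw [(iterate_stoppedStep_congr h t).1]

lemma afterExcursion_congr (h : ∀ u, T.Desc v u → r' u = r u) (hu : T.Desc v u) :
    T.afterExcursion v r' u = T.afterExcursion v r u := by
  unfold afterExcursion finalRotors
  simp only [(iterate_stoppedStep_congr h _).2 u hu]

lemma afterExcursion_of_not_desc (hu : ¬ T.Desc v u) : T.afterExcursion v r u = r u :=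
  finalRotors_of_forall_eq fun t => iterate_stoppedStep_snd_of_not_desc hu t

open Classical in
lemma excursion_of_last (h : r v = Fin.last _) :
    T.ExcursionReturns v r ∧ T.afterExcursion v r = Function.update r v 0 := by
  have hv : (v, r).1 ≠ T.parent v := (T.adj_parent v).ne
  rw [ExcursionReturns, afterExcursion, ← finalRotors_step hv, ← hits_step hv, step_last h]
  exact ⟨hits_of_eq rfl, finalRotors_of_eq rfl⟩

lemma iterate_stoppedStep_child_ne_parent (hv : v ≠ T.root) (i : Fin (T.b v)) (t : ℕ) :
    ((T.stoppedStep v)^[t] (T.child v i, r)).1 ≠ T.parent v := by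
  have h := iterate_stoppedStep_fst (T.child v i) r t
  rw [T.parent_child] at h
  obtain h | h := h
  · rw [h]
    exact (T.adj_parent v).ne
  · exact ((Desc.refl.child i).trans h).ne_parent hv

open Classical in
lemma excursion_of_child_escapes (hv : v ≠ T.root) {i : Fin (T.b v)} (h : r v = i.castSucc)
    (hi : ¬ T.ExcursionReturns (T.child v i) (Function.update r v i.succ)) :
    ¬ T.ExcursionReturns v r ∧
      T.afterExcursion v r = T.afterExcursion (T.child v i) (Function.update r v i.succ) := by
  have hv' : (v, r).1 ≠ T.parent v := (T.adj_parent v).ne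
  rw [ExcursionReturns, T.parent_child] at hi
  rw [ExcursionReturns, afterExcursion, afterExcursion, T.parent_child, ← hits_step hv',
    ← finalRotors_step hv', step_castSucc h]
  exact not_hits_of_avoids hi (iterate_stoppedStep_child_ne_parent hv i)

open Classical in
lemma excursion_of_child_returns (hv : v ≠ T.root) {i : Fin (T.b v)} (h : r v = i.castSucc)
    (hi : T.ExcursionReturns (T.child v i) (Function.update r v i.succ)) :
    (T.ExcursionReturns v r ↔ T.ExcursionReturns v
        (T.afterExcursion (T.child v i) (Function.update r v i.succ))) ∧
      T.afterExcursion v r = T.afterExcursion v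
        (T.afterExcursion (T.child v i) (Function.update r v i.succ)) := by
  have hv' : (v, r).1 ≠ T.parent v := (T.adj_parent v).ne
  rw [ExcursionReturns, T.parent_child] at hi
  rw [ExcursionReturns, ExcursionReturns, afterExcursion, afterExcursion, afterExcursion,
    T.parent_child, ← hits_step hv', ← finalRotors_step hv', step_castSucc h]
  exact hi.restart (iterate_stoppedStep_child_ne_parent hv i)

end Excursion

section Recursion

/-- The number of particles that escape through the children of `v` when the `i`-th child receives
`m i` particles. -/
noncomputable def childEscapes (v : V) (r : T.RotorConfig) (m : Fin (T.b v) → ℕ) : ℕ :=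
  ∑ i, T.excursionEscapes (T.child v i) r (m i)

/-- The state `σ` of the subtree below `v`, when the rotors are `r` initially, after the rotor at
`v` has passed `k` times through the parent and `m i` times through the `i`-th child, and that child
has sent every particle it received on an excursion. -/
structure Served (v : V) (r σ : T.RotorConfig) (k : ℕ) (m : Fin (T.b v) → ℕ) : Prop where
  agree (i : Fin (T.b v)) (u : V) (hu : T.Desc (T.child v i) u) :
    σ u = (T.afterExcursion (T.child v i))^[m i] r u
  count (i : Fin (T.b v)) : (m i + if (i : ℕ) < r v then 1 else 0) =
    k + if (i : ℕ) < σ v then 1 else 0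

/-- The outcome of `n` excursions from `v`: of these, `k` return to the parent of `v`, and the
others escape through the children of `v`, the `i`-th of which receives `m i` particles. Since the
rotor at `v` serves its neighbours cyclically, all the `m i` are almost equal to `k`. -/
structure IsExcursionSplit (v : V) (r : T.RotorConfig) (n k : ℕ) (m : Fin (T.b v) → ℕ) :
    Prop where
  add_escapes : k + T.excursionEscapes v r n = n
  childEscapes_eq : T.childEscapes v r m = T.excursionEscapes v r n
  child_le_add_one (i : Fin (T.b v)) : m i ≤ k + 1
  le_child_add_one (i : Fin (T.b v)) : k ≤ m i + 1
  le_child_of_rotor_le (i : Fin (T.b v)) (hi : (r v : ℕ) ≤ i) : k ≤ m i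

variable {T} {v : V} {r σ : T.RotorConfig} {k : ℕ} {m : Fin (T.b v) → ℕ}

open Classical in
lemma childEscapes_update (r : T.RotorConfig) (m : Fin (T.b v) → ℕ) (i : Fin (T.b v)) :
    T.childEscapes v r (Function.update m i (m i + 1)) = T.childEscapes v r m +
      if T.ExcursionReturns (T.child v i) ((T.afterExcursion (T.child v i))^[m i] r)
        then 0 else 1 := by
  simp only [childEscapes, Function.apply_update fun j => T.excursionEscapes (T.child v j) r]
  rw [Finset.sum_update_of_mem (Finset.mem_univ i), excursionEscapes_succ,
    Finset.sdiff_singleton_eq_erase, ← Finset.add_sum_erase _ _ (Finset.mem_univ i)]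
  omega

namespace Served

open Classical in
lemma serve_child (h : T.Served v r σ k m) {i : Fin (T.b v)} (hi : σ v = i.castSucc) :
    T.Served v r (T.afterExcursion (T.child v i) (Function.update σ v i.succ)) k
      (Function.update m i (m i + 1)) := by
  have hupdate (j : Fin (T.b v)) (u : V) (hu : T.Desc (T.child v j) u) :
      Function.update σ v i.succ u = (T.afterExcursion (T.child v j))^[m j] r u :=
    (Function.update_of_ne hu.ne_of_child _ _).trans (h.agree j u hu)
  refine ⟨fun j u hu => ?_, fun j => ?_⟩
  · obtain rfl | hj := eq_or_ne j i
    · rw [Function.update_self, Function.iterate_succ_apply']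
      exact afterExcursion_congr (hupdate j) hu
    · rw [Function.update_of_ne hj, ← hupdate j u hu]
      exact afterExcursion_of_not_desc fun hu' => hj (hu.child_index_unique hu')
  · have hcount := h.count j
    rw [afterExcursion_of_not_desc (not_desc_child i), Function.update_self, Function.update_apply]
    simp only [hi, Fin.val_castSucc, Fin.val_succ, Fin.ext_iff] at hcount ⊢
    grind

open Classical in
lemma serve_parent (h : T.Served v r σ k m) (hσ : σ v = Fin.last _) :
    T.Served v r (Function.update σ v 0) (k + 1) m where
  agree i u hu := by rw [Function.update_of_ne hu.ne_of_child, h.agree i u hu]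
  count i := by simpa [hσ] using h.count i

open Classical in
lemma excursion (hv : v ≠ T.root) (h : T.Served v r σ k m) :
    ∃ k' m', T.Served v r (T.afterExcursion v σ) k' m' ∧
      k' + T.childEscapes v r m' = k + T.childEscapes v r m + 1 ∧
      T.childEscapes v r m' = T.childEscapes v r m + if T.ExcursionReturns v σ then 0 else 1 := by
  induction hd : T.b v - (σ v : ℕ) generalizing σ m with
  | zero =>
    have hlast : σ v = Fin.last _ := Fin.ext (by simp only [Fin.val_last]; omega)
    obtain ⟨hreturns, hafter⟩ := excursion_of_last hlast
    exact ⟨k + 1, m, hafter ▸ h.serve_parent hlast, by omega, by rw [if_pos hreturns]; rfl⟩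
  | succ d ih =>
    obtain ⟨i, hi⟩ : ∃ i : Fin (T.b v), σ v = i.castSucc := ⟨⟨σ v, by omega⟩, rfl⟩
    have hserved := h.serve_child hi
    have hcongr : T.ExcursionReturns (T.child v i) (Function.update σ v i.succ) ↔
        T.ExcursionReturns (T.child v i) ((T.afterExcursion (T.child v i))^[m i] r) :=
      excursionReturns_congr fun u hu => by
        rw [Function.update_of_ne hu.ne_of_child, h.agree i u hu]
    have hsum := childEscapes_update r m i
    rw [← hcongr] at hsum
    by_cases hchild : T.ExcursionReturns (T.child v i) (Function.update σ v i.succ)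
    · obtain ⟨hreturns, hafter⟩ := excursion_of_child_returns hv hi hchild
      rw [if_pos hchild, add_zero] at hsum
      rw [hafter, hreturns, ← hsum]
      refine ih hserved ?_
      rw [afterExcursion_of_not_desc (not_desc_child i), Function.update_self, Fin.val_succ]
      rw [hi, Fin.val_castSucc] at hd
      omega
    · obtain ⟨hescapes, hafter⟩ := excursion_of_child_escapes hv hi hchild
      rw [if_neg hchild] at hsum
      exact ⟨k, _, hafter ▸ hserved, by rw [hsum, add_assoc], by rw [hsum, if_neg hescapes]⟩

lemma exists_iterate (hv : v ≠ T.root) (r : T.RotorConfig) (n : ℕ) :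
    ∃ k m, T.Served v r ((T.afterExcursion v)^[n] r) k m ∧ k + T.childEscapes v r m = n ∧
      T.childEscapes v r m = T.excursionEscapes v r n := by
  induction n with
  | zero => exact ⟨0, 0, ⟨fun _ _ _ => rfl, fun _ => rfl⟩, by simp [childEscapes]⟩
  | succ n ih =>
    obtain ⟨k, m, h, hn, hE⟩ := ih
    obtain ⟨k', m', h', hn', hE'⟩ := h.excursion hv
    rw [Function.iterate_succ_apply']
    exact ⟨k', m', h', by rw [hn', hn], by rw [hE', hE, excursionEscapes_succ]⟩

end Served

lemma exists_isExcursionSplit (hv : v ≠ T.root) (r : T.RotorConfig) (n : ℕ) :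
    ∃ k m, T.IsExcursionSplit v r n k m := by
  obtain ⟨k, m, h, hn, hE⟩ := Served.exists_iterate hv r n
  refine ⟨k, m, hE ▸ hn, hE, fun i => ?_, fun i => ?_, fun i hi => ?_⟩ <;>
    have := h.count i <;> split_ifs at this <;> omega

namespace IsExcursionSplit

variable {n : ℕ}

lemma le (h : T.IsExcursionSplit v r n k m) : k ≤ n := h.add_escapes ▸ Nat.le_add_right _ _

lemma deficit_eq (h : T.IsExcursionSplit v r n k m) {a : Fin (T.b v) → ℝ} (ha : 0 ≤ ∑ i, a i) :
    (∑ i, a i) / (1 + ∑ i, a i) * n - T.excursionEscapes v r n =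
      (∑ i, (a i * k - T.excursionEscapes (T.child v i) r (m i))) / (1 + ∑ i, a i) := by
  have hn : (n : ℝ) = k + T.excursionEscapes v r n := by exact_mod_cast h.add_escapes.symm
  have hE : (T.excursionEscapes v r n : ℝ) = ∑ i, (T.excursionEscapes (T.child v i) r (m i) : ℝ) :=
    by exact_mod_cast h.childEscapes_eq.symm
  rw [Finset.sum_sub_distrib, ← Finset.sum_mul, ← hE, hn]
  field_simp
  ring

end IsExcursionSplit

end Recursion

section EscapeProb

/-- The probability that simple random walk from `v` gets `h` levels below `v` before it moves to
the parent of `v`, in the recursive form that results from its excursions through the children. -/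
noncomputable def levelProb : ℕ → V → ℝ
  | 0, _ => 1
  | h + 1, v => (∑ i, levelProb h (T.child v i)) / (1 + ∑ i, levelProb h (T.child v i))

/-- The probability that simple random walk from `v` never moves to the parent of `v`, as the limit
of `levelProb`. -/
noncomputable def excursionEscapeProb (v : V) : ℝ := ⨅ h, T.levelProb h v

variable {T}

lemma levelProb_nonneg (h : ℕ) (v : V) : 0 ≤ T.levelProb h v := by
  induction h generalizing v with
  | zero => exact zero_le_one
  | succ h ih =>
    have := Finset.sum_nonneg fun i (_ : i ∈ Finset.univ) => ih (T.child v i)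
    rw [levelProb]
    positivity

lemma sum_levelProb_nonneg (h : ℕ) (v : V) : 0 ≤ ∑ i, T.levelProb h (T.child v i) :=
  Finset.sum_nonneg fun _ _ => levelProb_nonneg h _

lemma levelProb_le_one (h : ℕ) (v : V) : T.levelProb h v ≤ 1 := by
  cases h with
  | zero => exact le_rfl
  | succ h =>
    have := sum_levelProb_nonneg (T := T) h v
    exact (div_le_one (by positivity)).2 (by linarith)

lemma antitone_levelProb (v : V) : Antitone fun h => T.levelProb h v := by
  refine antitone_nat_of_succ_le fun h => ?_
  induction h generalizing v with
  | zero => exact levelProb_le_one _ _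
  | succ h ih =>
    have hsum := Finset.sum_le_sum fun i (_ : i ∈ Finset.univ) => ih (T.child v i)
    have := sum_levelProb_nonneg (T := T) (h + 1) v
    rw [levelProb, levelProb, div_le_div_iff₀ (by positivity) (by linarith)]
    linarith

lemma tendsto_levelProb (v : V) :
    Tendsto (fun h => T.levelProb h v) atTop (𝓝 (T.excursionEscapeProb v)) :=
  tendsto_atTop_ciInf (antitone_levelProb v) ⟨0, Set.forall_mem_range.2 (levelProb_nonneg · v)⟩

lemma excursionEscapeProb_nonneg (v : V) : 0 ≤ T.excursionEscapeProb v :=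
  ge_of_tendsto' (tendsto_levelProb v) fun h => levelProb_nonneg h v

lemma excursionEscapeProb_le_one (v : V) : T.excursionEscapeProb v ≤ 1 :=
  le_of_tendsto' (tendsto_levelProb v) fun h => levelProb_le_one h v

lemma sum_excursionEscapeProb_nonneg (v : V) : 0 ≤ ∑ i, T.excursionEscapeProb (T.child v i) :=
  Finset.sum_nonneg fun _ _ => excursionEscapeProb_nonneg _

lemma excursionEscapeProb_eq (v : V) : T.excursionEscapeProb v =
    (∑ i, T.excursionEscapeProb (T.child v i)) /
      (1 + ∑ i, T.excursionEscapeProb (T.child v i)) := by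
  have hsum : Tendsto (fun h => ∑ i, T.levelProb h (T.child v i)) atTop
      (𝓝 (∑ i, T.excursionEscapeProb (T.child v i))) :=
    tendsto_finsetSum _ fun i _ => tendsto_levelProb _
  have hne : 1 + ∑ i, T.excursionEscapeProb (T.child v i) ≠ 0 := by
    have := sum_excursionEscapeProb_nonneg (T := T) v
    positivity
  exact tendsto_nhds_unique ((tendsto_add_atTop_iff_nat 1).2 (tendsto_levelProb v))
    (hsum.div (hsum.const_add 1) hne)

end EscapeProb

section UpperBound

variable {T} {v : V}

lemma exists_excursionEscapes_le (h : ℕ) (hv : v ≠ T.root) (r : T.RotorConfig) :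
    ∃ C : ℝ, ∀ n : ℕ, (T.excursionEscapes v r n : ℝ) ≤ T.levelProb h v * n + C := by
  induction h generalizing v with
  | zero =>
    refine ⟨0, fun n => ?_⟩
    simpa [levelProb] using excursionEscapes_le v r n
  | succ h ih =>
    choose C hC using fun i => ih (T.child_ne_root (v := v) i)
    have hS := sum_levelProb_nonneg (T := T) h v
    refine ⟨(∑ i, (T.levelProb h (T.child v i) + C i)) /
      (1 + ∑ i, T.levelProb h (T.child v i)), fun n => ?_⟩
    obtain ⟨k, m, hsplit⟩ := exists_isExcursionSplit hv r n
    have hchild (i : Fin (T.b v)) : -(T.levelProb h (T.child v i) + C i) ≤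
        T.levelProb h (T.child v i) * k - T.excursionEscapes (T.child v i) r (m i) := by
      have hm : (m i : ℝ) ≤ k + 1 := by exact_mod_cast hsplit.child_le_add_one i
      have hmul := mul_le_mul_of_nonneg_left hm (levelProb_nonneg (T := T) h (T.child v i))
      linarith [hC i (m i)]
    have hdeficit : -((∑ i, (T.levelProb h (T.child v i) + C i)) /
        (1 + ∑ i, T.levelProb h (T.child v i))) ≤
          T.levelProb (h + 1) v * n - T.excursionEscapes v r n := by
      rw [levelProb, hsplit.deficit_eq hS, ← neg_div, ← Finset.sum_neg_distrib]
      gcongr with i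
      exact hchild i
    linarith

lemma eventually_excursionEscapes_div_lt (hv : v ≠ T.root) (r : T.RotorConfig) {a : ℝ}
    (ha : T.excursionEscapeProb v < a) :
    ∀ᶠ n : ℕ in atTop, (T.excursionEscapes v r n : ℝ) / n < a := by
  obtain ⟨h, hh⟩ := ((tendsto_levelProb v).eventually_lt_const ha).exists
  obtain ⟨C, hC⟩ := exists_excursionEscapes_le h hv r
  have hlim : Tendsto (fun n : ℕ => T.levelProb h v + C / n) atTop (𝓝 (T.levelProb h v)) := by
    simpa using (tendsto_const_div_atTop_nhds_zero_nat C).const_add (T.levelProb h v)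
  filter_upwards [hlim.eventually_lt_const hh, eventually_gt_atTop 0] with n hn hpos
  refine lt_of_le_of_lt ?_ hn
  rw [div_le_iff₀ (by positivity), add_mul, div_mul_cancel₀ _ (by positivity)]
  exact hC n

end UpperBound

section LowerBound

variable {T} {v : V} {r : T.RotorConfig}

/-- No rotor in the subtree below `v` is about to point to the parent of its vertex. -/
def IsOutward (v : V) (r : T.RotorConfig) : Prop := ∀ u, T.Desc v u → (r u : ℕ) < T.b u

namespace IsOutward

lemma child (h : T.IsOutward v r) (i : Fin (T.b v)) : T.IsOutward (T.child v i) r :=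
  fun u hu => h u ((Desc.refl.child i).trans hu)

lemma not_excursionReturns (h : T.IsOutward v r) (hv : v ≠ T.root) :
    ¬ T.ExcursionReturns v r := by
  classical
  have hbelow (t : ℕ) : T.Desc v (T.step^[t] (v, r)).1 ∧
      ∀ u, T.Desc (T.step^[t] (v, r)).1 u → (T.step^[t] (v, r)).2 u = r u := by
    induction t with
    | zero => exact ⟨.refl, fun _ _ => rfl⟩
    | succ t ih =>
      rw [Function.iterate_succ_apply']
      generalize T.step^[t] (v, r) = x at ih
      obtain ⟨a, σ⟩ := x
      obtain ⟨hva, hσ⟩ := ih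
      obtain ⟨i, hi⟩ : ∃ i : Fin (T.b a), σ a = i.castSucc :=
        ⟨(σ a).castLT ((congrArg Fin.val (hσ a .refl)).trans_lt (h a hva)), rfl⟩
      rw [step_castSucc hi]
      exact ⟨hva.child i, fun u hu => (Function.update_of_ne hu.ne_of_child _ _).trans
        (hσ u ((Desc.refl.child i).trans hu))⟩
  rw [ExcursionReturns, hits_iff_exists_iterate_step]
  rintro ⟨t, ht⟩
  exact (hbelow t).1.ne_parent hv ht

lemma one_le_excursionEscapes (h : T.IsOutward v r) (hv : v ≠ T.root) {n : ℕ} (hn : 1 ≤ n) :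
    1 ≤ T.excursionEscapes v r n := by
  refine le_trans ?_ (excursionEscapes_mono v r hn)
  rw [excursionEscapes_succ, Function.iterate_zero_apply, if_neg (h.not_excursionReturns hv)]
  exact Nat.le_add_left 1 _

end IsOutward

namespace IsExcursionSplit

variable {n k : ℕ} {m : Fin (T.b v) → ℕ}

lemma excursionEscapes_child_le (h : T.IsExcursionSplit v r n k m) (i : Fin (T.b v)) :
    T.excursionEscapes (T.child v i) r (m i) ≤ T.excursionEscapes v r n := by
  rw [← h.childEscapes_eq]
  exact Finset.single_le_sum (f := fun i => T.excursionEscapes (T.child v i) r (m i))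
    (fun _ _ => Nat.zero_le _) (Finset.mem_univ i)

/-- A child that receives fewer particles than the parent of `v` comes before the initial position
of the rotor at `v`. So it is not the last child, through which a particle escapes. -/
lemma excursionEscapes_child_lt (h : T.IsExcursionSplit v r n k m) (hr : T.IsOutward v r)
    {i : Fin (T.b v)} (hi : m i < k) :
    T.excursionEscapes (T.child v i) r (m i) < T.excursionEscapes v r n := by
  have hb : (r v : ℕ) < T.b v := hr v .refl
  have hir : (i : ℕ) < r v := by
    by_contra! hle
    exact hi.not_ge (h.le_child_of_rotor_le i hle)
  let l : Fin (T.b v) := ⟨T.b v - 1, by omega⟩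
  have hrl : (r v : ℕ) ≤ l := Nat.le_sub_one_of_lt hb
  have hl : 1 ≤ T.excursionEscapes (T.child v l) r (m l) :=
    (hr.child l).one_le_excursionEscapes (T.child_ne_root l)
      ((Nat.zero_lt_of_lt hi).trans_le (h.le_child_of_rotor_le l hrl))
  have hil : i ≠ l := fun hil => hir.not_ge (hil ▸ hrl)
  have hpair := Finset.sum_le_sum_of_subset
    (f := fun i => T.excursionEscapes (T.child v i) r (m i)) (Finset.subset_univ {i, l})
  rw [Finset.sum_pair hil] at hpair
  rw [← h.childEscapes_eq, childEscapes]
  omega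

end IsExcursionSplit

namespace IsOutward

/-- Below an outward vertex, a child that receives one particle less than the parent of `v` loses at
most its escape probability, but its escape number is strictly smaller than that of `v`. -/
lemma excursionEscapeProb_mul_sub_le (hr : T.IsOutward v r) (hv : v ≠ T.root) (n : ℕ) :
    T.excursionEscapeProb v * n - T.excursionEscapes v r n ≤
      T.excursionEscapeProb v * min (T.excursionEscapes v r n : ℝ) √(2 * n) := by
  induction n using Nat.strong_induction_on generalizing v with
  | _ n ih =>
  obtain rfl | hn := n.eq_zero_or_pos
  · simp
  obtain ⟨k, m, hsplit⟩ := exists_isExcursionSplit hv r n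
  set E := T.excursionEscapes v r n
  have hE : 1 ≤ E := hr.one_le_excursionEscapes hv hn
  have hkn : k + E = n := hsplit.add_escapes
  have hchild (i : Fin (T.b v)) :
      T.excursionEscapeProb (T.child v i) * k - T.excursionEscapes (T.child v i) r (m i) ≤
        T.excursionEscapeProb (T.child v i) * min (E : ℝ) √(2 * n) := by
    have hα := excursionEscapeProb_nonneg (T := T) (T.child v i)
    obtain hkm | hmk := le_or_gt k (m i)
    · have hmono := excursionEscapes_mono (T.child v i) r hkm
      have hle : (T.excursionEscapes (T.child v i) r k : ℝ) ≤ E := by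
        exact_mod_cast hmono.trans (hsplit.excursionEscapes_child_le i)
      calc _ ≤ T.excursionEscapeProb (T.child v i) * k -
            T.excursionEscapes (T.child v i) r k := by gcongr
        _ ≤ _ := ih k (by omega) (hr.child i) (T.child_ne_root i)
        _ ≤ _ := by gcongr; exact hsplit.le
    · obtain rfl : k = m i + 1 := le_antisymm (hsplit.le_child_add_one i) hmk
      have hmin := min_sqrt_add_one_le (e := E) (n := n)
        (e' := T.excursionEscapes (T.child v i) r (m i)) (n' := m i)
        (by exact_mod_cast hsplit.excursionEscapes_child_lt hr hmk)
        (by exact_mod_cast (by omega : m i + E ≤ n)) (Nat.cast_nonneg _) (Nat.cast_nonneg _)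
      have hih := ih (m i) (by omega) (hr.child i) (T.child_ne_root i)
      push_cast
      linarith [mul_le_mul_of_nonneg_left hmin hα]
  rw [excursionEscapeProb_eq, hsplit.deficit_eq (sum_excursionEscapeProb_nonneg v),
    div_mul_eq_mul_div, Finset.sum_mul]
  have := sum_excursionEscapeProb_nonneg (T := T) v
  gcongr with i
  exact hchild i

end IsOutward

lemma exists_excursionEscapeProb_mul_sub_le_of_isOutward (hr : T.IsOutward v r)
    (hv : v ≠ T.root) : ∃ C : ℝ, ∀ n : ℕ,
      T.excursionEscapeProb v * n - T.excursionEscapes v r n ≤ C * (1 + √n) := by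
  refine ⟨√2, fun n => (hr.excursionEscapeProb_mul_sub_le hv n).trans ?_⟩
  calc T.excursionEscapeProb v * min (T.excursionEscapes v r n : ℝ) √(2 * n)
      ≤ 1 * √(2 * n) := by
        gcongr
        exacts [excursionEscapeProb_le_one v, min_le_right _ _]
    _ = √2 * √n := by rw [one_mul, Real.sqrt_mul zero_le_two]
    _ ≤ √2 * (1 + √n) := by gcongr; linarith

lemma exists_excursionEscapeProb_mul_sub_le_of_child (hv : v ≠ T.root)
    (h : ∀ i, ∃ C : ℝ, ∀ n : ℕ, T.excursionEscapeProb (T.child v i) * n -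
      T.excursionEscapes (T.child v i) r n ≤ C * (1 + √n)) :
    ∃ C : ℝ, ∀ n : ℕ,
      T.excursionEscapeProb v * n - T.excursionEscapes v r n ≤ C * (1 + √n) := by
  choose C hC using h
  refine ⟨∑ i, (1 + |C i|), fun n => ?_⟩
  obtain ⟨k, m, hsplit⟩ := exists_isExcursionSplit hv r n
  have hchild (i : Fin (T.b v)) : T.excursionEscapeProb (T.child v i) * k -
      T.excursionEscapes (T.child v i) r (m i) ≤ (1 + |C i|) * (1 + √n) := by
    set l := min (m i) k
    have hmono : (T.excursionEscapes (T.child v i) r l : ℝ) ≤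
        T.excursionEscapes (T.child v i) r (m i) := by
      exact_mod_cast excursionEscapes_mono (T.child v i) r (min_le_left (m i) k)
    have hk : (k : ℝ) ≤ l + 1 := by
      have := hsplit.le_child_add_one i
      exact_mod_cast (by omega : k ≤ l + 1)
    have hl : C i * (1 + √l) ≤ |C i| * (1 + √n) := by
      gcongr
      exacts [le_abs_self _, (min_le_right _ _).trans hsplit.le]
    have hmul := mul_le_mul_of_nonneg_left hk (excursionEscapeProb_nonneg (T := T) (T.child v i))
    have hone := excursionEscapeProb_le_one (T := T) (T.child v i)
    linarith [hC i l, Real.sqrt_nonneg (n : ℝ)]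
  have hS := sum_excursionEscapeProb_nonneg (T := T) v
  rw [excursionEscapeProb_eq, hsplit.deficit_eq hS, Finset.sum_mul]
  exact (div_le_div_of_nonneg_right (Finset.sum_le_sum fun i _ => hchild i) (by positivity)).trans
    (div_le_self (by positivity) (by linarith))

lemma exists_excursionEscapeProb_mul_sub_le (hv : v ≠ T.root)
    (hr : {u | T.Desc v u ∧ (r u : ℕ) = T.b u}.Finite) : ∃ C : ℝ, ∀ n : ℕ,
      T.excursionEscapeProb v * n - T.excursionEscapes v r n ≤ C * (1 + √n) := by
  obtain ⟨N, hN⟩ := (hr.image T.depth).bddAbove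
  obtain ⟨j, hj⟩ : ∃ j, N < T.depth v + j := ⟨N + 1, by omega⟩
  induction j generalizing v with
  | zero =>
    refine exists_excursionEscapeProb_mul_sub_le_of_isOutward (fun u hu => ?_) hv
    refine lt_of_le_of_ne (Nat.lt_succ_iff.1 (r u).is_lt) fun he => ?_
    have hle : T.depth u ≤ N := hN ⟨u, ⟨hu, he⟩, rfl⟩
    have := hu.depth_le
    omega
  | succ j ih =>
    refine exists_excursionEscapeProb_mul_sub_le_of_child hv fun i => ?_
    have hsub : {u | T.Desc (T.child v i) u ∧ (r u : ℕ) = T.b u} ⊆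
        {u | T.Desc v u ∧ (r u : ℕ) = T.b u} := fun u hu =>
      ⟨(Desc.refl.child i).trans hu.1, hu.2⟩
    exact ih (T.child_ne_root i) (hr.subset hsub) (fun d hd => hN (Set.image_mono hsub hd))
      (by rw [T.depth_child]; omega)

lemma eventually_lt_excursionEscapes_div (hv : v ≠ T.root)
    (hr : {u | T.Desc v u ∧ (r u : ℕ) = T.b u}.Finite) {a : ℝ}
    (ha : a < T.excursionEscapeProb v) :
    ∀ᶠ n : ℕ in atTop, a < (T.excursionEscapes v r n : ℝ) / n := by
  obtain ⟨C, hC⟩ := exists_excursionEscapeProb_mul_sub_le hv hr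
  have hsqrt : Tendsto (fun n : ℕ => 1 / √n) atTop (𝓝 0) :=
    (tendsto_const_nhds.div_atTop Real.tendsto_sqrt_atTop).comp tendsto_natCast_atTop_atTop
  have hlim : Tendsto (fun n : ℕ => T.excursionEscapeProb v - C * (1 / n + 1 / √n)) atTop
      (𝓝 (T.excursionEscapeProb v)) := by
    simpa using ((tendsto_one_div_atTop_nhds_zero_nat.add hsqrt).const_mul C).const_sub
      (T.excursionEscapeProb v)
  filter_upwards [hlim.eventually_const_lt ha, eventually_gt_atTop 0] with n hn hpos
  have hn0 : (0 : ℝ) < n := Nat.cast_pos.2 hpos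
  have hfactor : C * (1 / n + 1 / √n) * n = C * (1 + √n) := by
    rw [mul_assoc, add_mul, one_div_mul_cancel hn0.ne', one_div_mul_eq_div, Real.div_sqrt]
  refine hn.trans_le ?_
  rw [le_div_iff₀ hn0, sub_mul, hfactor]
  linarith [hC n]

lemma tendsto_excursionEscapes_div (hv : v ≠ T.root)
    (hr : {u | T.Desc v u ∧ (r u : ℕ) = T.b u}.Finite) :
    Tendsto (fun n : ℕ => (T.excursionEscapes v r n : ℝ) / n) atTop
      (𝓝 (T.excursionEscapeProb v)) :=
  tendsto_order.2 ⟨fun _ ha => eventually_lt_excursionEscapes_div hv hr ha,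
    fun _ ha => eventually_excursionEscapes_div_lt hv r ha⟩

end LowerBound

section HitProb

open Classical in
/-- The probability that simple random walk from a given vertex visits the root by a given time. -/
noncomputable def hitProb : ℕ → V → ℝ
  | 0, v => if v = T.root then 1 else 0
  | t + 1, v => if v = T.root then 1 else (∑ i, hitProb t (T.nbr v i)) / (T.b v + 1)

/-- The probability that simple random walk from `v` ever visits the root, as the limit of
`hitProb`. -/
noncomputable def rootHitProb (v : V) : ℝ := ⨆ t, T.hitProb t v

variable {T} {v : V}

lemma hitProb_root (t : ℕ) : T.hitProb t T.root = 1 := by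
  cases t <;> exact if_pos rfl

lemma hitProb_zero_of_ne (hv : v ≠ T.root) : T.hitProb 0 v = 0 := if_neg hv

lemma hitProb_succ_of_ne (t : ℕ) (hv : v ≠ T.root) :
    T.hitProb (t + 1) v = (∑ i, T.hitProb t (T.nbr v i)) / (T.b v + 1) := if_neg hv

lemma hitProb_succ_mul (t : ℕ) (hv : v ≠ T.root) : T.hitProb (t + 1) v * (T.b v + 1) =
    T.hitProb t (T.parent v) + ∑ i, T.hitProb t (T.child v i) := by
  rw [hitProb_succ_of_ne t hv, div_mul_cancel₀ _ (by positivity), Fin.sum_univ_succ]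
  rfl

lemma hitProb_nonneg (t : ℕ) (v : V) : 0 ≤ T.hitProb t v := by
  induction t generalizing v with
  | zero => rw [hitProb]; split_ifs <;> norm_num
  | succ t ih =>
    have := Finset.sum_nonneg fun i (_ : i ∈ Finset.univ) => ih (T.nbr v i)
    rw [hitProb]
    split_ifs <;> positivity

lemma hitProb_le_one (t : ℕ) (v : V) : T.hitProb t v ≤ 1 := by
  obtain rfl | hv := eq_or_ne v T.root
  · exact (hitProb_root t).le
  induction t generalizing v with
  | zero => exact (hitProb_zero_of_ne hv).trans_le zero_le_one
  | succ t ih =>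
    have hle (u : V) : T.hitProb t u ≤ 1 := by
      obtain rfl | hu := eq_or_ne u T.root
      exacts [(hitProb_root t).le, ih u hu]
    rw [hitProb_succ_of_ne t hv, div_le_one (by positivity)]
    exact (Finset.sum_le_card_nsmul _ _ 1 fun i _ => hle _).trans (by simp)

lemma monotone_hitProb (v : V) : Monotone fun t => T.hitProb t v := by
  refine monotone_nat_of_le_succ fun t => ?_
  obtain rfl | hv := eq_or_ne v T.root
  · rw [hitProb_root, hitProb_root]
  induction t generalizing v with
  | zero => exact (hitProb_zero_of_ne hv).trans_le (hitProb_nonneg _ _)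
  | succ t ih =>
    rw [hitProb_succ_of_ne _ hv, hitProb_succ_of_ne _ hv]
    gcongr with i
    obtain hi | hi := eq_or_ne (T.nbr v i : V) T.root
    exacts [by rw [hi, hitProb_root, hitProb_root], ih _ hi]

lemma tendsto_hitProb (v : V) :
    Tendsto (fun t => T.hitProb t v) atTop (𝓝 (T.rootHitProb v)) :=
  tendsto_atTop_ciSup (monotone_hitProb v) ⟨1, Set.forall_mem_range.2 (hitProb_le_one · v)⟩

lemma rootHitProb_root : T.rootHitProb T.root = 1 := by
  simp only [rootHitProb, hitProb_root, ciSup_const]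

lemma rootHitProb_nonneg (v : V) : 0 ≤ T.rootHitProb v :=
  ge_of_tendsto' (tendsto_hitProb v) fun t => hitProb_nonneg t v

lemma rootHitProb_mul (hv : v ≠ T.root) : T.rootHitProb v * (T.b v + 1) =
    T.rootHitProb (T.parent v) + ∑ i, T.rootHitProb (T.child v i) := by
  refine tendsto_nhds_unique
    (((tendsto_add_atTop_iff_nat 1).2 (tendsto_hitProb v)).mul_const (T.b v + 1 : ℝ)) ?_
  simp only [hitProb_succ_mul _ hv]
  exact (tendsto_hitProb _).add (tendsto_finsetSum _ fun i _ => tendsto_hitProb _)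

lemma hitProb_le (t : ℕ) (hv : v ≠ T.root) :
    T.hitProb t v ≤ (1 - T.excursionEscapeProb v) * T.hitProb t (T.parent v) := by
  have hα (u : V) : 0 ≤ 1 - T.excursionEscapeProb u := sub_nonneg.2 (excursionEscapeProb_le_one u)
  induction t generalizing v with
  | zero =>
    rw [hitProb_zero_of_ne hv]
    exact mul_nonneg (hα v) (hitProb_nonneg _ _)
  | succ t ih =>
    have hchildren : ∑ i, T.hitProb t (T.child v i) ≤
        ∑ i, (1 - T.excursionEscapeProb (T.child v i)) * T.hitProb (t + 1) v := by
      refine Finset.sum_le_sum fun i _ => (ih (T.child_ne_root i)).trans ?_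
      rw [T.parent_child]
      exact mul_le_mul_of_nonneg_left (monotone_hitProb v t.le_succ) (hα _)
    have hS := sum_excursionEscapeProb_nonneg (T := T) v
    have hparent : T.hitProb t (T.parent v) ≤ T.hitProb (t + 1) (T.parent v) :=
      monotone_hitProb _ t.le_succ
    rw [sum_one_sub_mul] at hchildren
    rw [excursionEscapeProb_eq, one_sub_div_one_add hS, one_div_mul_eq_div,
      le_div_iff₀ (by positivity)]
    linarith [hitProb_succ_mul t hv]

lemma one_sub_levelProb_mul_le (h : ℕ) (hv : v ≠ T.root) :
    (1 - T.levelProb h v) * T.rootHitProb (T.parent v) ≤ T.rootHitProb v := by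
  induction h generalizing v with
  | zero => simpa [levelProb] using rootHitProb_nonneg v
  | succ h ih =>
    have hchildren : ∑ i, (1 - T.levelProb h (T.child v i)) * T.rootHitProb v ≤
        ∑ i, T.rootHitProb (T.child v i) := by
      gcongr with i
      simpa [T.parent_child] using ih (T.child_ne_root i)
    have hS := sum_levelProb_nonneg (T := T) h v
    rw [sum_one_sub_mul] at hchildren
    rw [levelProb, one_sub_div_one_add hS, one_div_mul_eq_div, div_le_iff₀ (by positivity)]
    linarith [rootHitProb_mul hv]

lemma rootHitProb_eq (hv : v ≠ T.root) :
    T.rootHitProb v = (1 - T.excursionEscapeProb v) * T.rootHitProb (T.parent v) :=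
  le_antisymm
    (le_of_tendsto_of_tendsto' (tendsto_hitProb v) ((tendsto_hitProb _).const_mul _)
      fun t => hitProb_le t hv)
    (le_of_tendsto' (((tendsto_levelProb v).const_sub 1).mul_const _)
      fun h => one_sub_levelProb_mul_le h hv)

end HitProb

section RandomWalk

variable [MeasurableSpace V] [DiscreteMeasurableSpace V]

lemma lintegral_srwKernel (v : V) (g : V → ENNReal) :
    ∫⁻ y, g y ∂(T.srwKernel v) = (∑ i, g (T.nbr v i)) * ((T.b v : ENNReal) + 1)⁻¹ := by
  change ∫⁻ y, g y ∂((PMF.uniformOfFintype (Fin (T.b v + 1))).map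
    fun i => (T.nbr v i : V)).toMeasure = _
  rw [← PMF.toMeasure_map _ _ .of_discrete, lintegral_map .of_discrete .of_discrete,
    lintegral_fintype, Finset.sum_mul]
  simp [PMF.toMeasure_apply_singleton _ _ (measurableSet_singleton _)]

lemma lintegral_srwKernel_root (g : V → ENNReal) :
    ∫⁻ y, g y ∂(T.srwKernel T.root) = g (T.parent T.root) := by
  have : IsEmpty (Fin (T.b T.root)) := by
    rw [T.b_root]
    infer_instance
  rw [lintegral_srwKernel, Fin.sum_univ_succ]
  simp [T.b_root, parent]

lemma lintegral_srwKernel_one_sub_hitProb (t : ℕ) {v : V} (hv : v ≠ T.root) :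
    ∫⁻ y, ENNReal.ofReal (1 - T.hitProb t y) ∂(T.srwKernel v) =
      ENNReal.ofReal (1 - T.hitProb (t + 1) v) := by
  have hnonneg (y : V) : 0 ≤ 1 - T.hitProb t y := sub_nonneg.2 (hitProb_le_one t y)
  have hinv : ((T.b v : ENNReal) + 1)⁻¹ = ENNReal.ofReal ((T.b v : ℝ) + 1)⁻¹ := by
    rw [ENNReal.ofReal_inv_of_pos (by positivity), ENNReal.ofReal_add (by positivity) zero_le_one]
    simp
  have hreal : (∑ i, (1 - T.hitProb t (T.nbr v i))) * ((T.b v : ℝ) + 1)⁻¹ =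
      1 - T.hitProb (t + 1) v := by
    rw [hitProb_succ_of_ne t hv, Finset.sum_sub_distrib, ← div_eq_mul_inv, sub_div]
    simp [div_self (Nat.cast_add_one_ne_zero (R := ℝ) (T.b v))]
  rw [lintegral_srwKernel, ← ENNReal.ofReal_sum_of_nonneg fun i _ => hnonneg _, hinv,
    ← ENNReal.ofReal_mul (Finset.sum_nonneg fun i _ => hnonneg _), hreal]

lemma killedOp_srwKernel (v : V) {f : V → ENNReal} {t : ℕ}
    (hf : ∀ y ≠ T.root, f y = ENNReal.ofReal (1 - T.hitProb t y)) :
    killedOp T.srwKernel {T.root} f v =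
      ∫⁻ y, ENNReal.ofReal (1 - T.hitProb t y) ∂(T.srwKernel v) := by
  rw [killedOp, setLIntegral_congr_fun (s := {T.root}ᶜ) .of_discrete hf]
  refine setLIntegral_eq_of_support_subset (Function.support_subset_iff'.2 fun y hy => ?_)
  obtain rfl : y = T.root := not_not.1 hy
  rw [hitProb_root, sub_self, ENNReal.ofReal_zero]

lemma killedOp_srwKernel_iterate_one (t : ℕ) {v : V} (hv : v ≠ T.root) :
    (killedOp T.srwKernel {T.root})^[t] 1 v = ENNReal.ofReal (1 - T.hitProb t v) := by
  induction t generalizing v with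
  | zero => simp [hitProb_zero_of_ne hv]
  | succ t ih =>
    rw [Function.iterate_succ_apply', T.killedOp_srwKernel v fun y hy => ih hy,
      T.lintegral_srwKernel_one_sub_hitProb t hv]

lemma killedOp_srwKernel_iterate_one_root (t : ℕ) :
    (killedOp T.srwKernel {T.root})^[t + 1] 1 T.root =
      ENNReal.ofReal (1 - T.hitProb t (T.parent T.root)) := by
  rw [Function.iterate_succ_apply',
    T.killedOp_srwKernel T.root fun y hy => T.killedOp_srwKernel_iterate_one t hy,
    lintegral_srwKernel_root]

lemma escapeProb_eq : T.escapeProb = T.excursionEscapeProb (T.parent T.root) := by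
  have hchain := (tendsto_add_atTop_iff_nat 1).2
    (tendsto_killedOp_iterate_one T.srwKernel (MeasurableSet.of_discrete (s := {T.root})) T.root)
  have hhit := ENNReal.tendsto_ofReal ((tendsto_hitProb (T := T) (T.parent T.root)).const_sub 1)
  simp only [killedOp_srwKernel_iterate_one_root] at hchain
  rw [rootHitProb_eq T.parent_root_ne_root, T.parent_parent_root, rootHitProb_root, mul_one,
    sub_sub_cancel] at hhit
  have hlaw := tendsto_nhds_unique hchain hhit
  rw [← ENNReal.toReal_ofReal (excursionEscapeProb_nonneg (T.parent T.root)), ← hlaw]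
  rfl

end RandomWalk

end RotorTree

theorem theorem3_general {V : Type*} [MeasurableSpace V] [DiscreteMeasurableSpace V]
    (T : RotorTree V) (r : T.RotorConfig)
    (hr : {v : V | v ≠ T.root ∧ (r v : ℕ) = T.b v}.Finite) :
    Tendsto (fun n : ℕ => (T.escapes r n : ℝ) / n) atTop (𝓝 T.escapeProb) := by
  simp only [T.escapeProb_eq, T.escapes_eq_excursionEscapes]
  exact RotorTree.tendsto_excursionEscapes_div T.parent_root_ne_root
    (hr.subset fun u hu => ⟨hu.1.ne_root T.parent_root_ne_root, hu.2⟩)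

theorem theorem3 {V : Type*} [Infinite V] [MeasurableSpace V] [DiscreteMeasurableSpace V]
    (T : RotorTree V) (r : T.RotorConfig)
    (hr : {v : V | v ≠ T.root ∧ (r v : ℕ) = T.b v}.Finite) :
    Tendsto (fun n : ℕ => (T.escapes r n : ℝ) / n) atTop (𝓝 T.escapeProb) :=
  theorem3_general T r hr
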